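/- **Theorem (Inverse Estimate).** Let $T\subset\mathbb R^2$ be a convex $n$-gon, $n\ge 3$, with vertices $\mathbf a_1,\dots,\mathbf a_n$ ordered counterclockwise (indices modulo $n$) and all interior angles $\theta_i$ in $(0,\pi)$. Let $\mathbf n_i$ be the outward unit normal of the edge $[\mathbf a_i,\mathbf a_{i+1}]$, let $M_i=\mathbf n_{i-1}\times\mathbf n_i$ with $\mathbf y\times\mathbf z=y_1z_2-y_2z_1$, and put $$h_i(\mathbf x)=(\mathbf a_i-\mathbf x)\cdot\mathbf n_i,\qquad w_i(\mathbf x)=M_i\prod_{j\ne i-1,i}h_j(\mathbf x),\qquad \lambda_i=\frac{w_i}{\sum_{j=1}^n w_j},$$ so that $\lambda_1,\dots,\lambda_n$ are the Wachspress coordinates of $T$. Set $V_T=\operatorname{span}\{\lambda_1,\dots,\lambda_n,\Delta\lambda_1,\dots,\Delta\lambda_n\}$. Let $h_T$ be the diameter of $T$, $\rho_T$ the diameter of the largest disk contained in $T$, and $h_{*,T}=\min_i\min_{j\neq i-1,i}h_j(\mathbf a_i)$. Let $C_1,C_2>0$ and $\theta^*<\pi$. There is a constant $C>0$, depending only on $C_1,C_2,\theta^*$,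 such that for every collection $\mathcal T$ of convex polygons (for instance the elements of all meshes of a mesh family) satisfying $$h_T\le C_1\rho_T,\qquad h_{*,T}\ge C_2h_T,\qquad \theta_i\le\theta^*\quad(1\le i\le n)\qquad\text{for all }T\in\mathcal T,$$ every $T\in\mathcal T$ and every $v_h\in V_T$, the function $v_h$ is differentiable at every point of the closed polygon $T$, $v_h^2$ and $|\nabla v_h|^2$ are integrable on $T$, and $$|v_h|_{1,T}\le C\,h_T^{-1}\,\|v_h\|_{0,T},$$ where $\|v\|_{0,T}=\big(\int_T v^2\big)^{1/2}$ and $|v|_{1,T}=\|\nabla v\|_{0,T}$. -/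

import Mathlib

open MeasureTheory
open scoped Real Laplacian Gradient

noncomputable section

/-- The Euclidean plane `ℝ²`. -/
abbrev Plane : Type := EuclideanSpace ℝ (Fin 2)

/-- The scalar cross product `y × z = y₁ z₂ - y₂ z₁`. -/
def cross (y z : Plane) : ℝ := y 0 * z 1 - y 1 * z 0

/-- A (nondegenerate) convex `n`-gon, `n ≥ 3`, given by its vertices `a_i` in counterclockwise
order, with cyclic indices `i ∈ ℤ/nℤ`. Strict convexity with counterclockwise orientation: every
vertex other than `a_i, a_{i+1}` lies strictly to the left of the directed edge from `a_i` to
`a_{i+1}`; in particular all interior angles lie strictly between `0` and `π`. -/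
structure ConvexPolygon where
  /-- The number of vertices. -/
  n : ℕ
  three_le : 3 ≤ n
  /-- The vertices. -/
  vertex : ZMod n → Plane
  left_of_edge : ∀ i j : ZMod n, j ≠ i → j ≠ i + 1 →
    0 < cross (vertex (i + 1) - vertex i) (vertex j - vertex i)

namespace ConvexPolygon

instance instNeZero (T : ConvexPolygon) : NeZero T.n :=
  ⟨by have := T.three_le; omega⟩

/-- The closed polygon as a subset of the plane. -/
def carrier (T : ConvexPolygon) : Set Plane := convexHull ℝ (Set.range T.vertex)

/-- The outward unit normal `n_i` of the edge `e_i = [a_i, a_{i+1}]`: the unit tangent rotated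
clockwise by a right angle. -/
def normal (T : ConvexPolygon) (i : ZMod T.n) : Plane :=
  ‖T.vertex (i + 1) - T.vertex i‖⁻¹ •
    !₂[(T.vertex (i + 1) - T.vertex i) 1, -(T.vertex (i + 1) - T.vertex i) 0]

/-- `M_i = n_{i-1} × n_i`. -/
def crossNormals (T : ConvexPolygon) (i : ZMod T.n) : ℝ := cross (T.normal (i - 1)) (T.normal i)

/-- `h_i(x) = (a_i - x) · n_i`, for `x ∈ T` the distance from `x` to the line through `e_i`. -/
def edgeDist (T : ConvexPolygon) (i : ZMod T.n) (x : Plane) : ℝ :=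
  inner ℝ (T.vertex i - x) (T.normal i)

/-- The Wachspress weight `w_i(x) = M_i ∏_{j ≠ i-1, i} h_j(x)`. -/
def weight (T : ConvexPolygon) (i : ZMod T.n) (x : Plane) : ℝ :=
  T.crossNormals i * ∏ j ∈ Finset.univ \ {i - 1, i}, T.edgeDist j x

/-- The Wachspress coordinate `λ_i = w_i / ∑_j w_j`. -/
def wachspress (T : ConvexPolygon) (i : ZMod T.n) (x : Plane) : ℝ :=
  T.weight i x / ∑ j, T.weight j x

/-- `V_T = span {λ_1, …, λ_n, Δλ_1, …, Δλ_n}`. -/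
def shapeSpace (T : ConvexPolygon) : Submodule ℝ (Plane → ℝ) :=
  Submodule.span ℝ
    (Set.range T.wachspress ∪ Set.range fun i : ZMod T.n => Δ (T.wachspress i))

/-- The diameter `h_T`. -/
def diam (T : ConvexPolygon) : ℝ := Metric.diam T.carrier

/-- The diameter `ρ_T` of the largest disk contained in `T`. -/
def inDiam (T : ConvexPolygon) : ℝ :=
  sSup {d : ℝ | ∃ (c : Plane) (r : ℝ), 0 ≤ r ∧ Metric.closedBall c r ⊆ T.carrier ∧ d = 2 * r}

/-- `h_{*,T} = min_i min_{j ≠ i-1, i} h_j(a_i)`. -/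
def minDist (T : ConvexPolygon) : ℝ :=
  ⨅ i : ZMod T.n, ⨅ j : {j : ZMod T.n // j ≠ i - 1 ∧ j ≠ i}, T.edgeDist j (T.vertex i)

/-- The interior angle `θ_i` at the vertex `a_i`. -/
def interiorAngle (T : ConvexPolygon) (i : ZMod T.n) : ℝ :=
  EuclideanGeometry.angle (T.vertex (i - 1)) (T.vertex i) (T.vertex (i + 1))

end ConvexPolygon

/-- Shape regularity, with constants `C₁`, `C₂`, `θmax`, of a collection of convex polygonal
elements (for instance of all the elements of all the meshes of a mesh family). -/
structure ShapeRegular (C₁ C₂ θmax : ℝ) (𝒯 : Set ConvexPolygon) : Prop where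
  diam_le : ∀ T ∈ 𝒯, T.diam ≤ C₁ * T.inDiam
  le_minDist : ∀ T ∈ 𝒯, C₂ * T.diam ≤ T.minDist
  angle_le : ∀ T ∈ 𝒯, ∀ i : ZMod T.n, T.interiorAngle i ≤ θmax

/-- `‖v‖_{0,S} = (∫_S v²)^{1/2}`. -/
def l2Norm (S : Set Plane) (v : Plane → ℝ) : ℝ := √(∫ x in S, v x ^ 2)

/-- `|v|_{1,S} = ‖∇v‖_{0,S}`. -/
def h1Seminorm (S : Set Plane) (v : Plane → ℝ) : ℝ := √(∫ x in S, ‖∇ v x‖ ^ 2)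

end

/-! Put `W = ∑ w_j`, a polynomial of degree at most `n - 2`. Each `λ_i` is `w_i / W`, so every `v ∈
V_T` is `p / W ^ 3` with `deg p ≤ 3 (n - 2)` wherever `W ≠ 0` (`isPolyDivPow_of_mem_shapeSpace`).
Polynomials of bounded degree form a finite-dimensional space, so equivalence of norms and scaling
bound `p` and `∇p` on a dilated disk by the `L²` norm of `p` on the disk itself
(`exists_bound_closedBall`). By `h_T ≤ C₁ ρ_T` some disk inside `T` has a fixed dilate containing
`T`.

Passing between `p` and `v` costs only constants: on `T` the denominator `W` lies between positive
multiples of `h_T ^ (n - 2)` (`le_weightSum`, `weightSum_le`), and `h_T |∇W|` is at most such a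
multiple. The quotient rule then gives `|∇v| ≤ G h_T⁻² ‖v‖` pointwise (`exists_norm_fderiv_le`), and
integration over an area of order `h_T²` leaves `h_T⁻¹`.

The constant `G` depends on `n`, but `h_* ≥ C₂ h_T` keeps the vertices `C₂ h_T` apart, so a packing
argument bounds `n` (`exists_card_bound`). -/

/-! ### Polynomial functions and their inverse estimate on disks. -/

/-- The affine real functions on the plane. The power `affineFunctions ^ d` is the space of
polynomial functions of degree at most `d`. -/
def affineFunctions : Submodule ℝ (Plane → ℝ) :=
  LinearMap.range ({ toFun := fun q x => q.1 + q.2 x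
                     map_add' := fun p q => by ext x; simp; ring
                     map_smul' := fun c q => by ext x; simp; ring } :
    (ℝ × (Plane →L[ℝ] ℝ)) →ₗ[ℝ] (Plane → ℝ))

namespace affineFunctions

theorem mem_iff {f : Plane → ℝ} :
    f ∈ affineFunctions ↔ ∃ (a : ℝ) (l : Plane →L[ℝ] ℝ), f = fun x => a + l x := by
  constructor
  · rintro ⟨⟨a, l⟩, rfl⟩
    exact ⟨a, l, rfl⟩
  · rintro ⟨a, l, rfl⟩
    exact ⟨(a, l), rfl⟩

theorem const_mem (a : ℝ) : (fun _ => a) ∈ affineFunctions :=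
  mem_iff.2 ⟨a, 0, by simp⟩

instance finiteDimensional_pow (d : ℕ) : FiniteDimensional ℝ ↥(affineFunctions ^ d) := by
  have h : affineFunctions.FG := by
    rw [affineFunctions, LinearMap.range_eq_map]
    exact Module.Finite.fg_top.map _
  exact Module.Finite.iff_fg.2 (h.pow d)

theorem mul_mem_pow {f g : Plane → ℝ} {d e : ℕ} (hf : f ∈ affineFunctions ^ d)
    (hg : g ∈ affineFunctions ^ e) : f * g ∈ affineFunctions ^ (d + e) := by
  rw [pow_add]
  exact Submodule.mul_mem_mul hf hg

theorem prod_mem_pow {ι : Type*} (s : Finset ι) {f : ι → Plane → ℝ}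
    (hf : ∀ i ∈ s, f i ∈ affineFunctions) :
    (fun x => ∏ i ∈ s, f i x) ∈ affineFunctions ^ s.card := by
  classical
  induction s using Finset.induction_on with
  | empty => exact Submodule.one_le.1 (le_refl (1 : Submodule ℝ (Plane → ℝ)))
  | insert a s ha ih =>
    have h := Submodule.mul_mem_mul (hf a (Finset.mem_insert_self a s))
      (ih fun i hi => hf i (Finset.mem_insert_of_mem hi))
    rw [Finset.card_insert_of_notMem ha, pow_succ']
    convert h using 1
    ext x
    simp [Finset.prod_insert ha]

theorem analyticOnNhd {f : Plane → ℝ} {d : ℕ} (hf : f ∈ affineFunctions ^ d) :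
    AnalyticOnNhd ℝ f Set.univ := by
  induction hf using Submodule.pow_induction_on_left' with
  | algebraMap r => exact analyticOnNhd_const
  | add x y i hx hy ihx ihy => exact ihx.add ihy
  | mem_mul m hm i x hx ih =>
    obtain ⟨a, l, rfl⟩ := mem_iff.1 hm
    exact (analyticOnNhd_const.add (l.analyticOnNhd _)).mul ih

theorem contDiff {f : Plane → ℝ} {d : ℕ} (hf : f ∈ affineFunctions ^ d) {k : WithTop ℕ∞} :
    ContDiff ℝ k f :=
  (analyticOnNhd hf).contDiff

theorem differentiable {f : Plane → ℝ} {d : ℕ} (hf : f ∈ affineFunctions ^ d) :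
    Differentiable ℝ f :=
  (contDiff (k := 1) hf).differentiable (by simp)

/-- Keeping the exponent `d` is enough: in the quotient rule the factor `W` raises the degree by `m`
anyway. -/
theorem fderiv_apply_mem {f : Plane → ℝ} {d : ℕ} (hf : f ∈ affineFunctions ^ d) (e : Plane) :
    (fun x => fderiv ℝ f x e) ∈ affineFunctions ^ d := by
  induction hf using Submodule.pow_induction_on_left' with
  | algebraMap r =>
    have : (fun x => fderiv ℝ (algebraMap ℝ (Plane → ℝ) r) x e) = 0 := by
      ext x
      have : (algebraMap ℝ (Plane → ℝ) r) = fun _ => r := rfl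
      simp [this]
    rw [this]
    exact Submodule.zero_mem _
  | add f g i hf hg ihf ihg =>
    convert Submodule.add_mem _ ihf ihg using 1
    ext x
    simp [fderiv_add (differentiable hf x) (differentiable hg x)]
  | mem_mul m hm i f hf ih =>
    obtain ⟨a, l, rfl⟩ := mem_iff.1 hm
    have hd : ∀ x, HasFDerivAt (fun x => a + l x) l x := fun x => l.hasFDerivAt.const_add a
    have h1 : (fun _ : Plane => l e) * f ∈ affineFunctions ^ (i + 1) := by
      rw [pow_succ']
      exact Submodule.mul_mem_mul (const_mem _) hf
    have h2 := Submodule.mul_mem_mul hm ih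
    rw [← pow_succ'] at h2
    convert Submodule.add_mem _ h1 h2 using 1
    ext x
    have := ((hd x).mul (differentiable hf x).hasFDerivAt).fderiv
    simp only [this, Pi.add_apply, Pi.mul_apply]
    simp
    ring

theorem comp_affine_mem {f : Plane → ℝ} {d : ℕ} (hf : f ∈ affineFunctions ^ d) (c : Plane)
    (r : ℝ) : (fun x => f (c + r • x)) ∈ affineFunctions ^ d := by
  induction hf using Submodule.pow_induction_on_left' with
  | algebraMap s => exact Submodule.mem_one.2 ⟨s, rfl⟩
  | add f g i hf hg ihf ihg => exact Submodule.add_mem _ ihf ihg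
  | mem_mul m hm i f hf ih =>
    obtain ⟨a, l, rfl⟩ := mem_iff.1 hm
    rw [Nat.succ_eq_add_one, pow_succ']
    refine Submodule.mul_mem_mul (mem_iff.2 ⟨a + l c, r • l, ?_⟩) ih
    ext x
    simp
    ring

/-- A continuous function vanishing almost everywhere on the open disk vanishes there identically,
and analyticity carries this to the plane. -/
theorem eq_zero_of_integral_sq_eq_zero {f : Plane → ℝ} {d : ℕ} (hf : f ∈ affineFunctions ^ d)
    (h : ∫ x in Metric.closedBall 0 1, f x ^ 2 = 0) : f = 0 := by
  have hc : Continuous f := (contDiff (k := 0) hf).continuous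
  rw [setIntegral_eq_zero_iff_of_nonneg_ae (ae_of_all _ fun x => sq_nonneg _)
    ((hc.pow 2).continuousOn.integrableOn_compact (isCompact_closedBall _ _))] at h
  have h' : f =ᵐ[volume.restrict (Metric.ball 0 1)] 0 := by
    refine (ae_restrict_of_ae_restrict_of_subset Metric.ball_subset_closedBall h).mono fun x hx => ?_
    simpa using hx
  have h2 := Measure.eqOn_open_of_ae_eq h' Metric.isOpen_ball hc.continuousOn continuousOn_const
  exact AnalyticOnNhd.eq_of_eventuallyEq (z₀ := 0) (analyticOnNhd hf) analyticOnNhd_const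
    (h2.eventuallyEq_of_mem (Metric.ball_mem_nhds _ one_pos))

theorem eq_sum_repr {ι : Type*} [Fintype ι] {d : ℕ}
    (b : Module.Basis ι ℝ ↥(affineFunctions ^ d)) (f : ↥(affineFunctions ^ d)) :
    (f : Plane → ℝ) = fun x => ∑ i, b.repr f i * (b i : Plane → ℝ) x := by
  have h := congrArg Subtype.val (b.sum_repr f)
  rw [Submodule.coe_sum] at h
  rw [← h]
  ext x
  simp [Finset.sum_apply]

/-- Equivalence of norms on the coefficients of polynomial functions. -/
theorem exists_coeff_sq_le {ι : Type*} [Fintype ι] {d : ℕ}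
    (b : Module.Basis ι ℝ ↥(affineFunctions ^ d)) :
    ∃ K : ℝ, 0 < K ∧ ∀ f : ↥(affineFunctions ^ d), ∀ i,
      |b.repr f i| ≤ K * √(∫ x in Metric.closedBall 0 1, (f : Plane → ℝ) x ^ 2) := by
  have hc : ∀ f : ↥(affineFunctions ^ d), Continuous (f : Plane → ℝ) := fun f =>
    (contDiff (k := 0) f.2).continuous
  set Q : (ι → ℝ) → ℝ := fun c =>
    ∫ x in Metric.closedBall 0 1, (∑ i, c i * (b i : Plane → ℝ) x) ^ 2 with hQ
  have hrepr : ∀ (f : ↥(affineFunctions ^ d)) x,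
      (f : Plane → ℝ) x = ∑ i, b.repr f i * (b i : Plane → ℝ) x := fun f x =>
    congrFun (eq_sum_repr b f) x
  have hQf : ∀ f : ↥(affineFunctions ^ d),
      Q (b.repr f) = ∫ x in Metric.closedBall 0 1, (f : Plane → ℝ) x ^ 2 := fun f => by
    simp only [hQ, hrepr f]
  have hQc : Continuous Q := by
    refine continuous_parametric_integral_of_continuous ?_ (isCompact_closedBall _ _)
    unfold Function.uncurry
    refine (continuous_finsetSum _ fun i _ => ?_).pow 2
    exact ((continuous_apply i).comp continuous_fst).mul ((hc (b i)).comp continuous_snd)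
  have hQs : ∀ (t : ℝ) c, Q (t • c) = t ^ 2 * Q c := by
    intro t c
    simp only [hQ, ← integral_const_mul, ← mul_pow, Finset.mul_sum, Pi.smul_apply, smul_eq_mul,
      mul_assoc]
  have hQ0 : ∀ c, 0 ≤ Q c := fun c => integral_nonneg fun x => sq_nonneg _
  have hQpos : ∀ c, c ≠ 0 → 0 < Q c := by
    intro c hne
    refine (hQ0 c).lt_of_ne fun h0 => hne ?_
    have h1 := hQf (b.equivFun.symm c)
    have h2 : (b.repr (b.equivFun.symm c) : ι → ℝ) = c := by
      rw [← b.equivFun_apply, LinearEquiv.apply_symm_apply]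
    rw [h2, ← h0] at h1
    have h3 := eq_zero_of_integral_sq_eq_zero (b.equivFun.symm c).2 h1.symm
    have h4 : b.equivFun.symm c = 0 := Subtype.ext h3
    exact (LinearEquiv.map_eq_zero_iff _).1 h4
  -- `m` is the minimum of the positive definite form `Q` on the unit sphere; the sphere is empty
  -- only for an empty basis, where any `m` serves.
  obtain ⟨m, hm, hmQ⟩ : ∃ m : ℝ, 0 < m ∧ ∀ c, ‖c‖ = 1 → m ≤ Q c := by
    by_cases hne : (Metric.sphere (0 : ι → ℝ) 1).Nonempty
    · obtain ⟨c, hcs, hmin⟩ :=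
        (isCompact_sphere (0 : ι → ℝ) 1).exists_isMinOn hne hQc.continuousOn
      refine ⟨Q c, hQpos c ?_, fun c' hc' => hmin (by simpa using hc')⟩
      rintro rfl
      simp at hcs
    · exact ⟨1, one_pos, fun c hc' => (hne ⟨c, by simpa using hc'⟩).elim⟩
  have key : ∀ c, m * ‖c‖ ^ 2 ≤ Q c := by
    intro c
    by_cases h0 : c = 0
    · simpa [h0] using hQ0 0
    have hn : 0 < ‖c‖ := norm_pos_iff.2 h0
    have h1 := hmQ (‖c‖⁻¹ • c) (by rw [norm_smul, norm_inv, norm_norm, inv_mul_cancel₀ hn.ne'])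
    rw [hQs, inv_pow, le_inv_mul_iff₀ (by positivity)] at h1
    linarith
  refine ⟨(√m)⁻¹, by positivity, fun f i => ?_⟩
  rw [← hQf, le_inv_mul_iff₀ (Real.sqrt_pos.2 hm)]
  refine Real.le_sqrt_of_sq_le ?_
  rw [mul_pow, Real.sq_sqrt hm.le]
  refine le_trans ?_ (key _)
  gcongr
  exact norm_le_pi_norm (b.repr f : ι → ℝ) i

/-- Expand in a basis: the coefficients are controlled by the `L²` norm on the unit disk, and the
basis functions and their derivatives are bounded on the compact disk of radius `R`. A radius `R >
1` lets the estimate reach beyond the disk of integration. -/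
theorem exists_bound_unitBall (d : ℕ) (R : ℝ) :
    ∃ K : ℝ, 0 < K ∧ ∀ f ∈ affineFunctions ^ d, ∀ x ∈ Metric.closedBall (0 : Plane) R,
      |f x| ≤ K * √(∫ y in Metric.closedBall 0 1, f y ^ 2) ∧
      ‖fderiv ℝ f x‖ ≤ K * √(∫ y in Metric.closedBall 0 1, f y ^ 2) := by
  let b := Module.finBasis ℝ ↥(affineFunctions ^ d)
  obtain ⟨K, hK, hb⟩ := exists_coeff_sq_le b
  have hc : ∀ i, ∃ B, ∀ x ∈ Metric.closedBall (0 : Plane) R,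
      |(b i : Plane → ℝ) x| + ‖fderiv ℝ (b i : Plane → ℝ) x‖ ≤ B := by
    intro i
    have h : Continuous fun x =>
        |(b i : Plane → ℝ) x| + ‖fderiv ℝ (b i : Plane → ℝ) x‖ :=
      (contDiff (k := 0) (b i).2).continuous.abs.add
        ((contDiff (k := 1) (b i).2).continuous_fderiv (by simp)).norm
    obtain ⟨B, hB⟩ := (isCompact_closedBall (0 : Plane) R).bddAbove_image h.continuousOn
    exact ⟨B, fun x hx => hB ⟨x, hx, rfl⟩⟩
  choose B hB using hc
  refine ⟨K * ∑ i, |B i| + 1, by positivity, fun f hf x hx => ?_⟩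
  set S := √(∫ y in Metric.closedBall 0 1, f y ^ 2)
  have hS0 : 0 ≤ S := Real.sqrt_nonneg _
  have hf' : f = fun x => ∑ i, b.repr ⟨f, hf⟩ i * (b i : Plane → ℝ) x := eq_sum_repr b ⟨f, hf⟩
  have hbS : ∀ i, |b.repr ⟨f, hf⟩ i| ≤ K * S := fun i => hb ⟨f, hf⟩ i
  have hd : HasFDerivAt f (∑ i, b.repr ⟨f, hf⟩ i • fderiv ℝ (b i : Plane → ℝ) x) x := by
    have hs : HasFDerivAt (fun x => ∑ i, b.repr ⟨f, hf⟩ i * (b i : Plane → ℝ) x)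
        (∑ i, b.repr ⟨f, hf⟩ i • fderiv ℝ (b i : Plane → ℝ) x) x :=
      HasFDerivAt.fun_sum fun i _ => (differentiable (b i).2 x).hasFDerivAt.const_mul _
    rwa [← hf'] at hs
  have hsum : ∑ i, K * S * |B i| ≤ (K * ∑ i, |B i| + 1) * S := by
    rw [← Finset.mul_sum]
    nlinarith
  constructor
  · refine le_trans ?_ hsum
    rw [show f x = ∑ i, b.repr ⟨f, hf⟩ i * (b i : Plane → ℝ) x from congrFun hf' x]
    refine (Finset.abs_sum_le_sum_abs _ _).trans (Finset.sum_le_sum fun i _ => ?_)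
    rw [abs_mul]
    have := hB i x hx
    have h2 : |(b i : Plane → ℝ) x| ≤ |B i| :=
      ((le_add_of_nonneg_right (norm_nonneg _)).trans this).trans (le_abs_self _)
    exact mul_le_mul (hbS i) h2 (abs_nonneg _) (by positivity)
  · refine le_trans ?_ hsum
    rw [hd.fderiv]
    refine (norm_sum_le _ _).trans (Finset.sum_le_sum fun i _ => ?_)
    rw [norm_smul, Real.norm_eq_abs]
    have := hB i x hx
    have h2 : ‖fderiv ℝ (b i : Plane → ℝ) x‖ ≤ |B i| :=
      ((le_add_of_nonneg_left (abs_nonneg _)).trans this).trans (le_abs_self _)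
    exact mul_le_mul (hbS i) h2 (norm_nonneg _) (by positivity)

theorem integral_closedBall_comp_affine (f : Plane → ℝ) (c : Plane) {r : ℝ} (hr : 0 < r) :
    ∫ y in Metric.closedBall 0 1, f (c + r • y) =
      (r ^ 2)⁻¹ * ∫ y in Metric.closedBall c r, f y := by
  have h1 := Measure.setIntegral_comp_smul_of_pos volume (fun y : Plane => f (c + y))
    (Metric.closedBall 0 1) hr
  rw [h1, smul_unitClosedBall_of_nonneg hr.le]
  simp only [finrank_euclideanSpace, Fintype.card_fin, smul_eq_mul]
  congr 1
  have h2 := (measurePreserving_add_left (volume : Measure Plane) c).setIntegral_preimage_emb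
    (measurableEmbedding_addLeft c) f (Metric.closedBall c r)
  rw [← h2]
  congr 2
  ext y
  simp [dist_eq_norm]

/-- The inverse estimate for polynomial functions, in scaled supremum form. -/
theorem exists_bound_closedBall (d : ℕ) (R : ℝ) :
    ∃ K : ℝ, 0 < K ∧ ∀ f ∈ affineFunctions ^ d, ∀ (c : Plane) (r : ℝ), 0 < r →
      ∀ x ∈ Metric.closedBall c (R * r),
        |f x| ≤ K / r * √(∫ y in Metric.closedBall c r, f y ^ 2) ∧
        ‖fderiv ℝ f x‖ ≤ K / r ^ 2 * √(∫ y in Metric.closedBall c r, f y ^ 2) := by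
  obtain ⟨K, hK, h⟩ := exists_bound_unitBall d R
  refine ⟨K, hK, fun f hf c r hr x hx => ?_⟩
  have hx' : r⁻¹ • (x - c) ∈ Metric.closedBall (0 : Plane) R := by
    rw [mem_closedBall_zero_iff, norm_smul, norm_inv, Real.norm_of_nonneg hr.le,
      inv_mul_le_iff₀ hr, mul_comm, ← dist_eq_norm]
    exact hx
  have hcx : c + r • r⁻¹ • (x - c) = x := by
    rw [smul_inv_smul₀ hr.ne']; abel
  obtain ⟨h1, h2⟩ := h _ (comp_affine_mem hf c r) _ hx'
  rw [integral_closedBall_comp_affine (fun y => f y ^ 2) c hr, Real.sqrt_mul (by positivity),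
    Real.sqrt_inv, Real.sqrt_sq hr.le] at h1 h2
  simp only [hcx] at h1
  constructor
  · refine h1.trans_eq ?_
    ring
  · have hd : HasFDerivAt (fun y : Plane => c + r • y) (r • ContinuousLinearMap.id ℝ Plane)
        (r⁻¹ • (x - c)) := ((hasFDerivAt_id _).const_smul r).const_add c
    have hd2 : HasFDerivAt f (fderiv ℝ f x) (c + r • r⁻¹ • (x - c)) := by
      rw [hcx]
      exact (differentiable hf x).hasFDerivAt
    have h3 := (HasFDerivAt.comp (f := fun y : Plane => c + r • y) _ hd2 hd).fderiv
    have h4 : (f ∘ fun y : Plane => c + r • y) = fun y => f (c + r • y) := rfl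
    rw [h4] at h3
    rw [h3, ContinuousLinearMap.comp_smul, ContinuousLinearMap.comp_id, norm_smul,
      Real.norm_of_nonneg hr.le, ← le_div_iff₀' hr] at h2
    refine h2.trans_eq ?_
    field_simp

end affineFunctions

/-! ### Quotients of polynomials by powers of a fixed polynomial. -/

/-- Where `W` does not vanish, `v` is `p / W ^ k` with a polynomial `p` of degree at most
`k * m`. -/
def IsPolyDivPow (W : Plane → ℝ) (m k : ℕ) (v : Plane → ℝ) : Prop :=
  ∃ p ∈ affineFunctions ^ (k * m), ∀ x, W x ≠ 0 → v x = p x / W x ^ k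

namespace IsPolyDivPow

variable {W : Plane → ℝ} {m k : ℕ} {u v : Plane → ℝ}

theorem eventuallyEq (hW : W ∈ affineFunctions ^ m) {p : Plane → ℝ}
    (hp : ∀ x, W x ≠ 0 → v x = p x / W x ^ k) {x : Plane} (hx : W x ≠ 0) :
    v =ᶠ[nhds x] fun y => p y / W y ^ k :=
  ((affineFunctions.contDiff (k := 0) hW).continuous.continuousAt.eventually_ne hx).mono
    fun y hy => hp y hy

theorem contDiffAt (hv : IsPolyDivPow W m k v) (hW : W ∈ affineFunctions ^ m) {x : Plane}
    (hx : W x ≠ 0) {j : WithTop ℕ∞} : ContDiffAt ℝ j v x := by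
  obtain ⟨p, hp, hvp⟩ := hv
  refine ContDiffAt.congr_of_eventuallyEq ?_ (eventuallyEq hW hvp hx)
  exact (affineFunctions.contDiff hp).contDiffAt.div
    ((affineFunctions.contDiff hW).contDiffAt.pow k) (pow_ne_zero _ hx)

theorem hasFDerivAt_of_eq (hW : W ∈ affineFunctions ^ m) {p : Plane → ℝ}
    (hp : p ∈ affineFunctions ^ (k * m)) (hvp : ∀ x, W x ≠ 0 → v x = p x / W x ^ k) {x : Plane}
    (hx : W x ≠ 0) :
    HasFDerivAt v ((W x ^ k)⁻¹ • fderiv ℝ p x -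
      (k * p x / W x ^ (k + 1)) • fderiv ℝ W x) x := by
  refine HasFDerivAt.congr_of_eventuallyEq ?_ (eventuallyEq hW hvp hx)
  have h1 := (affineFunctions.differentiable hp x).hasFDerivAt
  have h2 := (affineFunctions.differentiable hW x).hasFDerivAt
  -- The integer exponent `-k` treats `k = 0` together with the other cases.
  have h3 := h1.mul ((hasDerivAt_zpow (-(k : ℤ)) (W x) (Or.inl hx)).comp_hasFDerivAt x h2)
  have h4 : (fun y => p y / W y ^ k) = p * ((fun x => x ^ (-(k : ℤ))) ∘ W) := by
    ext y
    simp [div_eq_mul_inv]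
  rw [h4]
  refine h3.congr_fderiv ?_
  have h5 : W x ^ (-(k : ℤ) - 1) = (W x ^ (k + 1))⁻¹ := by
    rw [← zpow_natCast, ← zpow_neg]
    congr 1
    push_cast
    ring
  refine ContinuousLinearMap.ext fun e => ?_
  simp only [h5, zpow_neg, zpow_natCast, Function.comp_apply, Int.cast_neg, Int.cast_natCast,
    sub_apply, add_apply, smul_apply, smul_eq_mul]
  ring

theorem fderiv_apply (hv : IsPolyDivPow W m k v) (hW : W ∈ affineFunctions ^ m) (e : Plane) :
    IsPolyDivPow W m (k + 1) (fun x => fderiv ℝ v x e) := by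
  obtain ⟨p, hp, hvp⟩ := hv
  refine ⟨(fun x => fderiv ℝ p x e) * W - (k : ℝ) • (p * fun x => fderiv ℝ W x e), ?_, ?_⟩
  · rw [add_mul, one_mul]
    exact Submodule.sub_mem _
      (affineFunctions.mul_mem_pow (affineFunctions.fderiv_apply_mem hp e) hW)
      (Submodule.smul_mem _ _
        (affineFunctions.mul_mem_pow hp (affineFunctions.fderiv_apply_mem hW e)))
  · intro x hx
    simp only [(hasFDerivAt_of_eq hW hp hvp hx).fderiv, Pi.sub_apply, Pi.mul_apply,
      Pi.smul_apply, sub_apply, smul_apply, smul_eq_mul]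
    field_simp
    ring

theorem add (hu : IsPolyDivPow W m k u) (hv : IsPolyDivPow W m k v) :
    IsPolyDivPow W m k (u + v) := by
  obtain ⟨p, hp, hup⟩ := hu
  obtain ⟨q, hq, hvq⟩ := hv
  refine ⟨p + q, Submodule.add_mem _ hp hq, fun x hx => ?_⟩
  simp only [Pi.add_apply, hup x hx, hvq x hx, add_div]

theorem smul (hv : IsPolyDivPow W m k v) (t : ℝ) : IsPolyDivPow W m k (t • v) := by
  obtain ⟨p, hp, hvp⟩ := hv
  refine ⟨t • p, Submodule.smul_mem _ t hp, fun x hx => ?_⟩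
  simp only [Pi.smul_apply, hvp x hx, smul_eq_mul, mul_div_assoc]

theorem zero : IsPolyDivPow W m k 0 :=
  ⟨0, Submodule.zero_mem _, fun x _ => by simp⟩

theorem succ (hv : IsPolyDivPow W m k v) (hW : W ∈ affineFunctions ^ m) :
    IsPolyDivPow W m (k + 1) v := by
  obtain ⟨p, hp, hvp⟩ := hv
  refine ⟨p * W, ?_, fun x hx => ?_⟩
  · rw [add_mul, one_mul]
    exact affineFunctions.mul_mem_pow hp hW
  · rw [hvp x hx, Pi.mul_apply, pow_succ, mul_div_mul_right _ _ hx]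

theorem congr (hu : IsPolyDivPow W m k u) (h : ∀ x, W x ≠ 0 → v x = u x) :
    IsPolyDivPow W m k v := by
  obtain ⟨p, hp, hup⟩ := hu
  exact ⟨p, hp, fun x hx => (h x hx).trans (hup x hx)⟩

/-- The Laplacian is a sum of iterated directional derivatives, each of which raises the exponent of
`W` by one. -/
theorem laplacian (hv : IsPolyDivPow W m k v) (hW : W ∈ affineFunctions ^ m) :
    IsPolyDivPow W m (k + 2) (Δ v) := by
  let b := stdOrthonormalBasis ℝ Plane
  have hsum : ∀ s : Finset (Fin (Module.finrank ℝ Plane)), IsPolyDivPow W m (k + 2)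
      (∑ i ∈ s, fun x => fderiv ℝ (fun y => fderiv ℝ v y (b i)) x (b i)) := by
    intro s
    induction s using Finset.induction_on with
    | empty => exact zero
    | insert i s hi ih =>
      rw [Finset.sum_insert hi]
      exact ((hv.fderiv_apply hW (b i)).fderiv_apply hW (b i)).add ih
  refine (hsum Finset.univ).congr fun x hx => ?_
  rw [InnerProductSpace.laplacian_eq_iteratedFDeriv_orthonormalBasis v b, Finset.sum_apply]
  refine Finset.sum_congr rfl fun i _ => ?_
  have hd : DifferentiableAt ℝ (fderiv ℝ v) x :=
    ((hv.contDiffAt hW hx (j := 2)).fderiv_right (m := 1) (by norm_num)).differentiableAt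
      (by simp)
  rw [iteratedFDeriv_two_apply,
    fderiv_clm_apply hd (differentiableAt_const _)]
  simp

end IsPolyDivPow

/-! ### Shape functions as quotients by powers of `W`. -/

namespace ConvexPolygon

variable (T : ConvexPolygon)

/-- The denominator of the Wachspress coordinates. -/
noncomputable def weightSum (x : Plane) : ℝ := ∑ j, T.weight j x

theorem edgeDist_eq (i : ZMod T.n) :
    T.edgeDist i = fun x => inner ℝ (T.vertex i) (T.normal i) + -innerSL ℝ (T.normal i) x := by
  ext x
  rw [edgeDist, inner_sub_left, real_inner_comm (T.normal i) x, ← sub_eq_add_neg]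
  rfl

theorem edgeDist_mem (i : ZMod T.n) : T.edgeDist i ∈ affineFunctions :=
  affineFunctions.mem_iff.2 ⟨_, -innerSL ℝ (T.normal i), T.edgeDist_eq i⟩

theorem one_ne_zero' : (1 : ZMod T.n) ≠ 0 := by
  have : Fact (1 < T.n) := ⟨by have := T.three_le; omega⟩
  exact one_ne_zero

theorem two_ne_zero' : (2 : ZMod T.n) ≠ 0 := by
  intro h
  have h' : ((2 : ℕ) : ZMod T.n) = 0 := by exact_mod_cast h
  rw [ZMod.natCast_eq_zero_iff] at h'
  have := Nat.le_of_dvd (by norm_num) h'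
  have := T.three_le
  omega

theorem sub_one_ne (i : ZMod T.n) : i - 1 ≠ i := fun h => T.one_ne_zero' (by simpa using h)

theorem card_sdiff (i : ZMod T.n) :
    (Finset.univ \ {i - 1, i} : Finset (ZMod T.n)).card = T.n - 2 := by
  rw [Finset.card_sdiff_of_subset (Finset.subset_univ _), Finset.card_pair (T.sub_one_ne i),
    Finset.card_univ, ZMod.card]

theorem weight_mem (i : ZMod T.n) : T.weight i ∈ affineFunctions ^ (T.n - 2) := by
  have h := affineFunctions.prod_mem_pow (Finset.univ \ {i - 1, i} : Finset (ZMod T.n))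
    (f := T.edgeDist) fun j _ => T.edgeDist_mem j
  rw [T.card_sdiff] at h
  exact Submodule.smul_mem _ (T.crossNormals i) h

theorem weightSum_mem : T.weightSum ∈ affineFunctions ^ (T.n - 2) := by
  have h : T.weightSum = ∑ j, T.weight j := by
    ext x
    simp [weightSum]
  rw [h]
  exact Submodule.sum_mem _ fun i _ => T.weight_mem i

/-- The exponent is `1` for `λ_i` and `1 + 2` for `Δλ_i`; the former is raised to the common value
`3`. -/
theorem isPolyDivPow_of_mem_shapeSpace {v : Plane → ℝ} (hv : v ∈ T.shapeSpace) :
    IsPolyDivPow T.weightSum (T.n - 2) 3 v := by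
  have hl : ∀ i, IsPolyDivPow T.weightSum (T.n - 2) 1 (T.wachspress i) := fun i =>
    ⟨T.weight i, by simpa using T.weight_mem i, fun x _ => by simp [wachspress, weightSum]⟩
  induction hv using Submodule.span_induction with
  | mem v hv =>
    rcases hv with ⟨i, rfl⟩ | ⟨i, rfl⟩
    · exact ((hl i).succ T.weightSum_mem).succ T.weightSum_mem
    · exact (hl i).laplacian T.weightSum_mem
  | zero => exact .zero
  | add u v _ _ hu hv => exact hu.add hv
  | smul t v _ hv => exact hv.smul t

end ConvexPolygon

/-! ### Elementary geometry of the polygon. -/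

namespace ConvexPolygon

variable (T : ConvexPolygon)

theorem vertex_succ_ne (i : ZMod T.n) : T.vertex (i + 1) ≠ T.vertex i := by
  intro h
  have h1 := T.left_of_edge i (i + 2) (fun h => T.two_ne_zero' (by simpa using h))
    (fun h => T.one_ne_zero' (by linear_combination h))
  rw [h, sub_self] at h1
  simp [cross] at h1

theorem norm_normal (i : ZMod T.n) : ‖T.normal i‖ = 1 := by
  have h0 : ‖T.vertex (i + 1) - T.vertex i‖ ≠ 0 :=
    norm_ne_zero_iff.2 (sub_ne_zero.2 (T.vertex_succ_ne i))
  have h : ∀ a : Plane, ‖(!₂[a 1, -(a 0)] : Plane)‖ = ‖a‖ := fun a => by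
    simp [EuclideanSpace.norm_eq, Fin.sum_univ_two, add_comm]
  rw [normal, norm_smul, h, norm_inv, norm_norm, inv_mul_cancel₀ h0]

theorem vertex_mem_carrier (i : ZMod T.n) : T.vertex i ∈ T.carrier :=
  subset_convexHull ℝ _ ⟨i, rfl⟩

theorem isCompact_carrier : IsCompact T.carrier :=
  (Set.finite_range T.vertex).isCompact_convexHull ℝ

theorem dist_le_diam {x y : Plane} (hx : x ∈ T.carrier) (hy : y ∈ T.carrier) :
    dist x y ≤ T.diam :=
  Metric.dist_le_diam_of_mem T.isCompact_carrier.isBounded hx hy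

theorem diam_pos : 0 < T.diam :=
  (dist_pos.2 (T.vertex_succ_ne 0)).trans_le
    (T.dist_le_diam (T.vertex_mem_carrier _) (T.vertex_mem_carrier _))

theorem edgeDist_vertex_self (i : ZMod T.n) : T.edgeDist i (T.vertex i) = 0 := by
  simp [edgeDist]

theorem edgeDist_vertex_succ (i : ZMod T.n) : T.edgeDist i (T.vertex (i + 1)) = 0 := by
  simp only [edgeDist, normal, inner_smul_right]
  simp [PiLp.inner_apply, Fin.sum_univ_two]
  right
  ring

theorem minDist_le {i j : ZMod T.n} (h1 : j ≠ i - 1) (h2 : j ≠ i) :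
    T.minDist ≤ T.edgeDist j (T.vertex i) :=
  (ciInf_le (Set.finite_range _).bddBelow i).trans
    (ciInf_le (Set.finite_range fun j : {j : ZMod T.n // j ≠ i - 1 ∧ j ≠ i} =>
      T.edgeDist j (T.vertex i)).bddBelow ⟨j, h1, h2⟩)

theorem abs_edgeDist_le {x : Plane} (hx : x ∈ T.carrier) (j : ZMod T.n) :
    |T.edgeDist j x| ≤ T.diam := by
  refine (abs_real_inner_le_norm _ _).trans ?_
  rw [norm_normal, mul_one, ← dist_eq_norm]
  exact T.dist_le_diam (T.vertex_mem_carrier j) hx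

theorem exists_convex_weights {x : Plane} (hx : x ∈ T.carrier) :
    ∃ w ∈ stdSimplex ℝ (ZMod T.n), ∑ i, w i • T.vertex i = x := by
  let L : (ZMod T.n → ℝ) →ₗ[ℝ] Plane := Fintype.linearCombination ℝ T.vertex
  have hL : ∀ w, L w = ∑ i, w i • T.vertex i := fun w => Fintype.linearCombination_apply ..
  have h : T.carrier ⊆ L '' stdSimplex ℝ (ZMod T.n) := by
    refine convexHull_min ?_ ((convex_stdSimplex ℝ _).linear_image L)
    rintro _ ⟨i, rfl⟩
    exact ⟨Pi.single i 1, single_mem_stdSimplex ℝ i, by simp [L]⟩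
  obtain ⟨w, hw, rfl⟩ := h hx
  exact ⟨w, hw, (hL w).symm⟩

theorem edgeDist_sum {w : ZMod T.n → ℝ} (hw : ∑ i, w i = 1) (j : ZMod T.n) :
    T.edgeDist j (∑ i, w i • T.vertex i) = ∑ i, w i * T.edgeDist j (T.vertex i) := by
  have h : T.vertex j = ∑ i, w i • T.vertex j := by rw [← Finset.sum_smul, hw, one_smul]
  simp only [edgeDist]
  conv_lhs => rw [h]
  rw [← Finset.sum_sub_distrib, sum_inner]
  refine Finset.sum_congr rfl fun i _ => ?_
  rw [← smul_sub, real_inner_smul_left]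

theorem crossNormals_le_one (i : ZMod T.n) : T.crossNormals i ≤ 1 := by
  have h1 := EuclideanSpace.real_norm_sq_eq (T.normal (i - 1))
  have h2 := EuclideanSpace.real_norm_sq_eq (T.normal i)
  rw [norm_normal, Fin.sum_univ_two] at h1 h2
  rw [crossNormals, cross]
  nlinarith [sq_nonneg (T.normal (i - 1) 0 - T.normal i 1),
    sq_nonneg (T.normal (i - 1) 1 + T.normal i 0)]

/-- `M_i` is the sine of the turning angle at `a_i`. The identity turns a lower bound on
vertex-to-edge distances into one on `M_i`. -/
theorem edgeDist_vertex_pred (i : ZMod T.n) :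
    T.edgeDist i (T.vertex (i - 1)) = dist (T.vertex i) (T.vertex (i - 1)) * T.crossNormals i := by
  have h0 : ‖T.vertex i - T.vertex (i - 1)‖ ≠ 0 := by
    have := T.vertex_succ_ne (i - 1)
    rw [sub_add_cancel] at this
    exact norm_ne_zero_iff.2 (sub_ne_zero.2 this)
  rw [edgeDist, crossNormals, cross, dist_eq_norm]
  nth_rewrite 2 [normal]
  nth_rewrite 3 [normal]
  rw [sub_add_cancel]
  simp [PiLp.inner_apply, Fin.sum_univ_two]
  simp at h0
  field_simp
  simp [normal]
  ring

end ConvexPolygon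

/-! ### Bounds on `W`, on its gradient and on the number of vertices. -/

namespace ConvexPolygon

variable {T : ConvexPolygon} {C₂ : ℝ}

theorem mul_diam_le_edgeDist (hmin : C₂ * T.diam ≤ T.minDist) {i j : ZMod T.n} (h1 : j ≠ i - 1)
    (h2 : j ≠ i) : C₂ * T.diam ≤ T.edgeDist j (T.vertex i) :=
  hmin.trans (T.minDist_le h1 h2)

/-- The distance from `a_{i-1}` to the line of `e_i` is `|e_{i-1}| M_i`; it is at least `C₂ h_T`,
while `|e_{i-1}| ≤ h_T`. -/
theorem le_crossNormals (hC₂ : 0 < C₂) (hmin : C₂ * T.diam ≤ T.minDist) (i : ZMod T.n) :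
    C₂ ≤ T.crossNormals i := by
  have h1 : C₂ * T.diam ≤ T.edgeDist i (T.vertex (i - 1)) :=
    mul_diam_le_edgeDist hmin (fun h => T.two_ne_zero' (by linear_combination h))
      (T.sub_one_ne i).symm
  have h2 : dist (T.vertex i) (T.vertex (i - 1)) ≤ T.diam :=
    T.dist_le_diam (T.vertex_mem_carrier _) (T.vertex_mem_carrier _)
  rw [edgeDist_vertex_pred] at h1
  have h3 := T.diam_pos
  have h4 : 0 < C₂ * T.diam := by positivity
  have h5 : 0 < T.crossNormals i := pos_of_mul_pos_right (h4.trans_le h1) dist_nonneg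
  by_contra! h
  nlinarith

theorem edgeDist_vertex_nonneg (hC₂ : 0 < C₂) (hmin : C₂ * T.diam ≤ T.minDist)
    (i j : ZMod T.n) : 0 ≤ T.edgeDist j (T.vertex i) := by
  have := T.diam_pos
  by_cases h1 : j = i - 1
  · rw [eq_sub_iff_add_eq] at h1
    rw [← h1, edgeDist_vertex_succ]
  by_cases h2 : j = i
  · rw [h2, edgeDist_vertex_self]
  exact le_trans (by positivity) (mul_diam_le_edgeDist hmin h1 h2)

theorem edgeDist_nonneg (hC₂ : 0 < C₂) (hmin : C₂ * T.diam ≤ T.minDist) {x : Plane}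
    (hx : x ∈ T.carrier) (j : ZMod T.n) : 0 ≤ T.edgeDist j x := by
  obtain ⟨w, hw, rfl⟩ := T.exists_convex_weights hx
  rw [T.edgeDist_sum hw.2]
  exact Finset.sum_nonneg fun i _ => mul_nonneg (hw.1 i) (edgeDist_vertex_nonneg hC₂ hmin i j)

theorem weight_nonneg (hC₂ : 0 < C₂) (hmin : C₂ * T.diam ≤ T.minDist) {x : Plane}
    (hx : x ∈ T.carrier) (i : ZMod T.n) : 0 ≤ T.weight i x :=
  mul_nonneg (hC₂.le.trans (le_crossNormals hC₂ hmin i))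
    (Finset.prod_nonneg fun j _ => edgeDist_nonneg hC₂ hmin hx j)

/-- Among the convex coefficients of `x` some `w i` is at least `1/n`. Each `h_j` is affine and
nonnegative at the vertices, so `h_j(x) ≥ h_j(a_i)/n ≥ C₂ h_T/n` for `j ≠ i-1, i`. Thus the single
Wachspress weight of `a_i` already gives the bound. -/
theorem le_weightSum (hC₂ : 0 < C₂) (hmin : C₂ * T.diam ≤ T.minDist) {x : Plane}
    (hx : x ∈ T.carrier) :
    C₂ * (C₂ / T.n) ^ (T.n - 2) * T.diam ^ (T.n - 2) ≤ T.weightSum x := by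
  have hn : (0 : ℝ) < T.n := by
    have := T.three_le
    exact_mod_cast (by omega : 0 < T.n)
  have hd := T.diam_pos
  obtain ⟨w, hw, hwx⟩ := T.exists_convex_weights hx
  obtain ⟨i, -, hi⟩ : ∃ i ∈ (Finset.univ : Finset (ZMod T.n)), (T.n : ℝ)⁻¹ ≤ w i := by
    refine Finset.exists_le_of_sum_le Finset.univ_nonempty ?_
    rw [hw.2, Finset.sum_const, Finset.card_univ, ZMod.card, nsmul_eq_mul,
      mul_inv_cancel₀ hn.ne']
  have h1 : T.weight i x ≤ T.weightSum x :=
    Finset.single_le_sum (f := fun i => T.weight i x)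
      (fun j _ => weight_nonneg hC₂ hmin hx j) (Finset.mem_univ i)
  refine le_trans ?_ h1
  rw [weight, mul_assoc, ← mul_pow, ← T.card_sdiff i, ← Finset.prod_const]
  refine mul_le_mul (le_crossNormals hC₂ hmin i) (Finset.prod_le_prod (fun _ _ => by positivity) ?_)
    (by positivity) (hC₂.le.trans (le_crossNormals hC₂ hmin i))
  intro j hj
  simp only [Finset.mem_sdiff, Finset.mem_univ, true_and, Finset.mem_insert,
    Finset.mem_singleton, not_or] at hj
  rw [← hwx, T.edgeDist_sum hw.2]
  calc C₂ / T.n * T.diam = (T.n : ℝ)⁻¹ * (C₂ * T.diam) := by ring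
    _ ≤ w i * T.edgeDist j (T.vertex i) :=
      mul_le_mul hi (mul_diam_le_edgeDist hmin hj.1 hj.2) (by positivity) (hw.1 i)
    _ ≤ _ := Finset.single_le_sum (f := fun i => w i * T.edgeDist j (T.vertex i))
      (fun k _ => mul_nonneg (hw.1 k) (edgeDist_vertex_nonneg hC₂ hmin k j)) (Finset.mem_univ i)

theorem abs_crossNormals_le_one (hC₂ : 0 < C₂) (hmin : C₂ * T.diam ≤ T.minDist)
    (i : ZMod T.n) : |T.crossNormals i| ≤ 1 := by
  rw [abs_of_nonneg (hC₂.le.trans (le_crossNormals hC₂ hmin i))]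
  exact T.crossNormals_le_one i

theorem weightSum_le (hC₂ : 0 < C₂) (hmin : C₂ * T.diam ≤ T.minDist) {x : Plane}
    (hx : x ∈ T.carrier) : T.weightSum x ≤ T.n * T.diam ^ (T.n - 2) := by
  have h : ∀ i ∈ (Finset.univ : Finset (ZMod T.n)), T.weight i x ≤ T.diam ^ (T.n - 2) := by
    intro i _
    rw [weight, ← one_mul (T.diam ^ _), ← T.card_sdiff i, ← Finset.prod_const]
    exact mul_le_mul (T.crossNormals_le_one i)
      (Finset.prod_le_prod (fun j _ => edgeDist_nonneg hC₂ hmin hx j)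
        fun j _ => (le_abs_self _).trans (T.abs_edgeDist_le hx j))
      (Finset.prod_nonneg fun j _ => edgeDist_nonneg hC₂ hmin hx j) zero_le_one
  refine (Finset.sum_le_card_nsmul _ _ _ h).trans_eq ?_
  rw [Finset.card_univ, ZMod.card, nsmul_eq_mul]

theorem hasFDerivAt_edgeDist (j : ZMod T.n) (x : Plane) :
    HasFDerivAt (T.edgeDist j) (-innerSL ℝ (T.normal j)) x := by
  rw [T.edgeDist_eq j]
  exact (-innerSL ℝ (T.normal j) : Plane →L[ℝ] ℝ).hasFDerivAt.const_add _

/-- In the product rule each term loses one of its `n - 2` factors `h_j ≤ h_T`, which the prefactor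
`h_T` restores; there are `n (n - 2) ≤ n²` terms. -/
theorem diam_mul_norm_fderiv_weightSum_le (hC₂ : 0 < C₂) (hmin : C₂ * T.diam ≤ T.minDist)
    {x : Plane} (hx : x ∈ T.carrier) :
    T.diam * ‖fderiv ℝ T.weightSum x‖ ≤ T.n * T.n * T.diam ^ (T.n - 2) := by
  have hd := T.diam_pos
  set s : ZMod T.n → Finset (ZMod T.n) := fun i => Finset.univ \ {i - 1, i}
  have h1 : ∀ i, HasFDerivAt (T.weight i) (T.crossNormals i •
      ∑ j ∈ s i, (∏ k ∈ (s i).erase j, T.edgeDist k x) • -innerSL ℝ (T.normal j)) x := fun i =>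
    (HasFDerivAt.finsetProd fun j _ => hasFDerivAt_edgeDist j x).const_mul _
  have h2 : HasFDerivAt T.weightSum (∑ i, T.crossNormals i •
      ∑ j ∈ s i, (∏ k ∈ (s i).erase j, T.edgeDist k x) • -innerSL ℝ (T.normal j)) x :=
    HasFDerivAt.fun_sum fun i _ => h1 i
  rw [h2.fderiv]
  have h3 : ∀ i, ∀ j ∈ s i, ‖(∏ k ∈ (s i).erase j, T.edgeDist k x) • -innerSL ℝ (T.normal j)‖ ≤
      T.diam⁻¹ * T.diam ^ (T.n - 2) := by
    intro i j hj
    rw [norm_smul, norm_neg, innerSL_apply_norm, norm_normal, mul_one, norm_prod]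
    calc ∏ k ∈ (s i).erase j, ‖T.edgeDist k x‖ ≤ ∏ _k ∈ (s i).erase j, T.diam :=
          Finset.prod_le_prod (fun _ _ => norm_nonneg _) fun k _ => T.abs_edgeDist_le hx k
      _ = T.diam⁻¹ * T.diam ^ (T.n - 2) := by
          rw [eq_inv_mul_iff_mul_eq₀ hd.ne', Finset.mul_prod_erase (s i) (fun _ => T.diam) hj,
            Finset.prod_const, T.card_sdiff i]
  have h4 : ∀ i, ‖T.crossNormals i •
      ∑ j ∈ s i, (∏ k ∈ (s i).erase j, T.edgeDist k x) • -innerSL ℝ (T.normal j)‖ ≤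
      T.n * (T.diam⁻¹ * T.diam ^ (T.n - 2)) := by
    intro i
    rw [norm_smul, ← one_mul ((T.n : ℝ) * _)]
    refine mul_le_mul (abs_crossNormals_le_one hC₂ hmin i) ?_ (norm_nonneg _) zero_le_one
    refine (norm_sum_le_of_le _ (h3 i)).trans ?_
    rw [Finset.sum_const, T.card_sdiff i, nsmul_eq_mul]
    gcongr
    omega
  have h5 := norm_sum_le_of_le Finset.univ fun i _ => h4 i
  rw [Finset.sum_const, Finset.card_univ, ZMod.card, nsmul_eq_mul] at h5
  refine (mul_le_mul_of_nonneg_left h5 hd.le).trans_eq ?_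
  field_simp

/-- Each `h_k` is 1-Lipschitz, so it suffices to find an edge line through `a_i` that misses `a_j`.
-/
theorem le_dist_vertex (hmin : C₂ * T.diam ≤ T.minDist) {i j : ZMod T.n} (hij : i ≠ j) :
    C₂ * T.diam ≤ dist (T.vertex i) (T.vertex j) := by
  have key : ∀ k l m : ZMod T.n, k ≠ l - 1 → k ≠ l → T.edgeDist k (T.vertex m) = 0 →
      C₂ * T.diam ≤ dist (T.vertex m) (T.vertex l) := by
    intro k l m h1 h2 h3
    have h4 : T.edgeDist k (T.vertex l) =
        inner ℝ (T.vertex m - T.vertex l) (T.normal k) := by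
      rw [← sub_zero (T.edgeDist k (T.vertex l)), ← h3, edgeDist, edgeDist, ← inner_sub_left]
      congr 1
      abel
    refine (mul_diam_le_edgeDist hmin h1 h2).trans ?_
    rw [h4, dist_eq_norm]
    refine (real_inner_le_norm _ _).trans ?_
    rw [norm_normal, mul_one]
  -- The line of `e_i` serves unless it ends at `a_j`; then the line of `e_{i-1}` does.
  by_cases h : i = j - 1
  · have hs := T.edgeDist_vertex_succ (i - 1)
    rw [sub_add_cancel] at hs
    refine key (i - 1) j i (fun h' => T.sub_one_ne i ?_) (fun h' => T.two_ne_zero' ?_) hs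
    · rw [h', h]
    · linear_combination h - h'
  · exact key i j i h hij (T.edgeDist_vertex_self i)

/-- After scaling by `h_T⁻¹` the vertices lie in a unit disk at mutual distance at least `C₂`, so
each ball of radius `C₂/2` in a fixed finite cover contains at most one. -/
theorem exists_card_bound (hC₂ : 0 < C₂) :
    ∃ N : ℕ, ∀ T : ConvexPolygon, C₂ * T.diam ≤ T.minDist → T.n ≤ N := by
  obtain ⟨t, ht, hcov⟩ := Metric.totallyBounded_iff.1
    (isCompact_closedBall (0 : Plane) 1).totallyBounded (C₂ / 2) (by positivity)
  refine ⟨ht.toFinset.card, fun T hmin => ?_⟩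
  have hd := T.diam_pos
  have h1 : ∀ i, ∃ y ∈ t, dist (T.diam⁻¹ • (T.vertex i - T.vertex 0)) y < C₂ / 2 := by
    intro i
    have hm : T.diam⁻¹ • (T.vertex i - T.vertex 0) ∈ Metric.closedBall (0 : Plane) 1 := by
      rw [mem_closedBall_zero_iff, norm_smul, norm_inv, Real.norm_of_nonneg hd.le,
        inv_mul_le_iff₀ hd, mul_one, ← dist_eq_norm]
      exact T.dist_le_diam (T.vertex_mem_carrier _) (T.vertex_mem_carrier _)
    simpa using hcov hm
  choose y hyt hy using h1
  have hinj : Function.Injective y := by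
    intro i j hij
    by_contra hne
    have h2 := le_dist_vertex hmin hne
    have h3 : dist (T.diam⁻¹ • (T.vertex i - T.vertex 0))
        (T.diam⁻¹ • (T.vertex j - T.vertex 0)) < C₂ := by
      have h4 := hy j
      rw [← hij] at h4
      linarith [dist_triangle_right (T.diam⁻¹ • (T.vertex i - T.vertex 0))
        (T.diam⁻¹ • (T.vertex j - T.vertex 0)) (y i), hy i]
    rw [dist_smul₀, dist_sub_right, norm_inv, Real.norm_of_nonneg hd.le,
      inv_mul_lt_iff₀ hd] at h3
    linarith
  have h5 := Finset.card_le_card_of_injOn (s := (Finset.univ : Finset (ZMod T.n)))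
    (t := ht.toFinset) y (fun i _ => by simpa using hyt i) hinj.injOn
  rwa [Finset.card_univ, ZMod.card] at h5

/-- Instead of showing that the supremum `ρ_T` is attained, take a disk of diameter `2r > ρ_T/2`;
this is the source of the factor `4`. -/
theorem exists_closedBall_subset {C₁ : ℝ} (hC₁ : 0 < C₁) (h : T.diam ≤ C₁ * T.inDiam) :
    ∃ (c : Plane) (r : ℝ), 0 < r ∧ T.diam ≤ 4 * C₁ * r ∧ Metric.closedBall c r ⊆ T.carrier := by
  have hd := T.diam_pos
  have hin : 0 < T.inDiam := pos_of_mul_pos_right (hd.trans_le h) hC₁.le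
  obtain ⟨_, ⟨c, r, -, hsub, rfl⟩, hlt⟩ := exists_lt_of_lt_csSup
    (s := {d : ℝ | ∃ (c : Plane) (r : ℝ), 0 ≤ r ∧ Metric.closedBall c r ⊆ T.carrier ∧ d = 2 * r})
    (b := T.inDiam / 2)
    -- A disk of radius zero at a vertex shows that the set is nonempty.
    ⟨2 * 0, T.vertex 0, 0, le_rfl, by simpa using T.vertex_mem_carrier 0, rfl⟩
    (half_lt_self hin)
  refine ⟨c, r, by linarith, h.trans ?_, hsub⟩
  rw [mul_comm 4, mul_assoc]
  gcongr
  linarith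

end ConvexPolygon

/-! ### Regularity and gradient bounds for shape functions. -/

namespace ConvexPolygon

variable {T : ConvexPolygon} {C₁ C₂ : ℝ} {v : Plane → ℝ}

theorem weightSum_pos (hC₂ : 0 < C₂) (hmin : C₂ * T.diam ≤ T.minDist) {x : Plane}
    (hx : x ∈ T.carrier) : 0 < T.weightSum x := by
  have hn : (0 : ℝ) < T.n := by
    have := T.three_le
    exact_mod_cast (by omega : 0 < T.n)
  have hd := T.diam_pos
  exact lt_of_lt_of_le (by positivity) (le_weightSum hC₂ hmin hx)

theorem contDiffAt_of_mem_shapeSpace (hC₂ : 0 < C₂) (hmin : C₂ * T.diam ≤ T.minDist)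
    (hv : v ∈ T.shapeSpace) {x : Plane} (hx : x ∈ T.carrier) : ContDiffAt ℝ 2 v x :=
  (T.isPolyDivPow_of_mem_shapeSpace hv).contDiffAt T.weightSum_mem
    (weightSum_pos hC₂ hmin hx).ne'

theorem continuousOn_of_mem_shapeSpace (hC₂ : 0 < C₂) (hmin : C₂ * T.diam ≤ T.minDist)
    (hv : v ∈ T.shapeSpace) : ContinuousOn v T.carrier := fun _ hx =>
  (contDiffAt_of_mem_shapeSpace hC₂ hmin hv hx).continuousAt.continuousWithinAt

theorem integrableOn_sq (hC₂ : 0 < C₂) (hmin : C₂ * T.diam ≤ T.minDist)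
    (hv : v ∈ T.shapeSpace) : IntegrableOn (fun x => v x ^ 2) T.carrier :=
  ((continuousOn_of_mem_shapeSpace hC₂ hmin hv).pow 2).integrableOn_compact T.isCompact_carrier

theorem norm_gradient_eq (v : Plane → ℝ) (x : Plane) : ‖(∇ v) x‖ = ‖fderiv ℝ v x‖ := by
  simp [gradient]

theorem integrableOn_gradient_sq (hC₂ : 0 < C₂) (hmin : C₂ * T.diam ≤ T.minDist)
    (hv : v ∈ T.shapeSpace) : IntegrableOn (fun x => ‖(∇ v) x‖ ^ 2) T.carrier := by
  simp only [norm_gradient_eq]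
  have hc : ContinuousOn (fun x => ‖fderiv ℝ v x‖ ^ 2) T.carrier := fun x hx =>
    (((contDiffAt_of_mem_shapeSpace hC₂ hmin hv hx).fderiv_right
      (m := 1) (by norm_num)).continuousAt.norm.pow 2).continuousWithinAt
  exact hc.integrableOn_compact T.isCompact_carrier

/-- The `L²` norm of the numerator of `v` on an inscribed disk is controlled by that of `v`. -/
theorem sqrt_integral_numerator_le (hC₂ : 0 < C₂) (hmin : C₂ * T.diam ≤ T.minDist)
    (hv : v ∈ T.shapeSpace) {p : Plane → ℝ}
    (hvp : ∀ x, T.weightSum x ≠ 0 → v x = p x / T.weightSum x ^ 3) {B : Set Plane}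
    (hB : B ⊆ T.carrier) (hBc : IsCompact B) (hp : Continuous p) :
    √(∫ x in B, p x ^ 2) ≤ (T.n * T.diam ^ (T.n - 2)) ^ 3 * l2Norm T.carrier v := by
  have hd := T.diam_pos
  rw [l2Norm]
  refine Real.sqrt_le_iff.2 ⟨by positivity, ?_⟩
  rw [mul_pow _ (√_), Real.sq_sqrt (integral_nonneg fun x => sq_nonneg _),
    ← integral_const_mul]
  have hint : IntegrableOn (fun x => ((T.n * T.diam ^ (T.n - 2)) ^ 3) ^ 2 * v x ^ 2) T.carrier :=
    (integrableOn_sq hC₂ hmin hv).const_mul (((T.n * T.diam ^ (T.n - 2)) ^ 3) ^ 2)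
  refine le_trans ?_ (setIntegral_mono_set hint (ae_of_all _ fun x => by positivity)
    hB.eventuallyLE)
  refine setIntegral_mono_on ((hp.pow 2).continuousOn.integrableOn_compact hBc)
    (hint.mono_set hB) hBc.measurableSet fun x hx => ?_
  have hW := weightSum_pos hC₂ hmin (hB hx)
  have h1 : p x = T.weightSum x ^ 3 * v x := by
    rw [hvp x hW.ne']
    field_simp
  rw [h1, mul_pow]
  gcongr
  exact weightSum_le hC₂ hmin (hB hx)

/-- The gradient of a shape function is bounded pointwise by its scaled `L²` norm. -/
theorem exists_norm_fderiv_le (hC₁ : 0 < C₁) (hC₂ : 0 < C₂) (n : ℕ) :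
    ∃ G : ℝ, 0 ≤ G ∧ ∀ T : ConvexPolygon, T.n = n → T.diam ≤ C₁ * T.inDiam →
      C₂ * T.diam ≤ T.minDist → ∀ v ∈ T.shapeSpace, ∀ x ∈ T.carrier,
        ‖fderiv ℝ v x‖ ≤ G * (T.diam ^ 2)⁻¹ * l2Norm T.carrier v := by
  obtain ⟨K, hK, hbound⟩ := affineFunctions.exists_bound_closedBall (3 * (n - 2)) (4 * C₁)
  set a : ℝ := C₂ * (C₂ / n) ^ (n - 2) with ha
  -- The two summands come from `∇p / W ^ 3` and `3 p ∇W / W ^ 4`, with `W ≥ a h_T ^ (n - 2)`.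
  refine ⟨K * (4 * C₁) ^ 2 * n ^ 3 / a ^ 3 + 3 * K * (4 * C₁) * n ^ 5 / a ^ 4, by positivity, ?_⟩
  rintro T rfl hin hmin v hv x hx
  have hn : (0 : ℝ) < T.n := by
    have := T.three_le
    exact_mod_cast (by omega : 0 < T.n)
  have ha0 : 0 < a := by positivity
  have hd := T.diam_pos
  obtain ⟨p, hp, hvp⟩ := T.isPolyDivPow_of_mem_shapeSpace hv
  obtain ⟨c, r, hr, hrd, hsub⟩ := exists_closedBall_subset hC₁ hin
  have hxc : x ∈ Metric.closedBall c (4 * C₁ * r) :=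
    (T.dist_le_diam hx (hsub (Metric.mem_closedBall_self hr.le))).trans hrd
  obtain ⟨hp1, hp2⟩ := hbound p hp c r hr x hxc
  have hS := sqrt_integral_numerator_le hC₂ hmin hv hvp hsub (isCompact_closedBall c r)
    (affineFunctions.contDiff (k := 0) hp).continuous
  set S := √(∫ y in Metric.closedBall c r, p y ^ 2)
  set M := l2Norm T.carrier v
  have hM0 : 0 ≤ M := Real.sqrt_nonneg _
  have hS0 : 0 ≤ S := Real.sqrt_nonneg _
  have hW := weightSum_pos hC₂ hmin hx
  have hWl := le_weightSum hC₂ hmin hx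
  have hWd := diam_mul_norm_fderiv_weightSum_le hC₂ hmin hx
  rw [← ha] at hWl
  set D := T.diam ^ (T.n - 2)
  have hD : 0 < D := by positivity
  rw [← le_div_iff₀' hd] at hWd
  have hrinv : r⁻¹ ≤ 4 * C₁ / T.diam := by
    rw [inv_le_comm₀ hr (by positivity), inv_div, div_le_iff₀' (by positivity)]
    exact hrd
  have hp1' : |p x| ≤ K * (4 * C₁ / T.diam) * ((T.n * D) ^ 3 * M) := by
    refine hp1.trans ?_
    rw [div_eq_mul_inv]
    gcongr
  have hp2' : ‖fderiv ℝ p x‖ ≤ K * (4 * C₁ / T.diam) ^ 2 * ((T.n * D) ^ 3 * M) := by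
    refine hp2.trans ?_
    rw [div_eq_mul_inv, ← inv_pow]
    gcongr
  rw [(IsPolyDivPow.hasFDerivAt_of_eq T.weightSum_mem hp hvp hW.ne').fderiv]
  refine (norm_sub_le _ _).trans ?_
  rw [norm_smul, norm_smul, norm_inv, norm_pow, norm_div, norm_mul, norm_pow,
    Real.norm_of_nonneg hW.le, Real.norm_eq_abs (p x)]
  calc (T.weightSum x ^ 3)⁻¹ * ‖fderiv ℝ p x‖ +
        ‖((3 : ℕ) : ℝ)‖ * |p x| / T.weightSum x ^ (3 + 1) * ‖fderiv ℝ T.weightSum x‖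
      ≤ ((a * D) ^ 3)⁻¹ * (K * (4 * C₁ / T.diam) ^ 2 * ((T.n * D) ^ 3 * M)) +
        3 * (K * (4 * C₁ / T.diam) * ((T.n * D) ^ 3 * M)) / (a * D) ^ (3 + 1) *
          (T.n * T.n * D / T.diam) := by
        have h3 : ‖((3 : ℕ) : ℝ)‖ = 3 := by norm_num
        rw [h3]
        gcongr
    -- All powers of `D` cancel, so both terms scale as `h_T⁻²`.
    _ = _ := by
        field_simp
        ring

/-- `T` lies in the disk of radius `h_T` about any vertex, which bounds its area. -/
theorem h1Seminorm_le {G : ℝ} (hG : 0 ≤ G) (hC₂ : 0 < C₂) (hmin : C₂ * T.diam ≤ T.minDist)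
    (hv : v ∈ T.shapeSpace) (h : ∀ x ∈ T.carrier, ‖fderiv ℝ v x‖ ≤ G) :
    h1Seminorm T.carrier v ≤ √(volume.real (Metric.ball (0 : Plane) 1)) * T.diam * G := by
  have hd := T.diam_pos
  have hvol : volume.real T.carrier ≤ T.diam ^ 2 * volume.real (Metric.ball (0 : Plane) 1) := by
    have h1 := Measure.addHaar_real_closedBall (volume : Measure Plane) (T.vertex 0) hd.le
    rw [finrank_euclideanSpace, Fintype.card_fin] at h1
    rw [← h1]
    exact measureReal_mono
      (fun x hx => T.dist_le_diam hx (T.vertex_mem_carrier 0)) measure_closedBall_lt_top.ne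
  rw [h1Seminorm]
  refine Real.sqrt_le_iff.2 ⟨by positivity, ?_⟩
  rw [mul_pow, mul_pow, Real.sq_sqrt measureReal_nonneg]
  calc ∫ x in T.carrier, ‖(∇ v) x‖ ^ 2 ≤ ∫ _x in T.carrier, G ^ 2 := by
        refine setIntegral_mono_on (integrableOn_gradient_sq hC₂ hmin hv)
          (integrableOn_const T.isCompact_carrier.measure_lt_top.ne)
          T.isCompact_carrier.measurableSet fun x hx => ?_
        rw [norm_gradient_eq]
        gcongr
        exact h x hx
    _ = volume.real T.carrier * G ^ 2 := by rw [setIntegral_const, smul_eq_mul]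
    _ ≤ _ := by
        rw [mul_comm (volume.real (Metric.ball _ _))]
        gcongr

end ConvexPolygon

/-! ### The inverse estimate. -/

open ConvexPolygon in
theorem mainTheorem3 (C₁ C₂ θmax : ℝ) (hC₁ : 0 < C₁) (hC₂ : 0 < C₂) (hθ : θmax < π) :
    ∃ C : ℝ, 0 < C ∧
      ∀ 𝒯 : Set ConvexPolygon, ShapeRegular C₁ C₂ θmax 𝒯 →
        ∀ T ∈ 𝒯, ∀ v ∈ T.shapeSpace,
          (∀ x ∈ T.carrier, DifferentiableAt ℝ v x) ∧
          IntegrableOn (fun x => v x ^ 2) T.carrier ∧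
          IntegrableOn (fun x => ‖∇ v x‖ ^ 2) T.carrier ∧
          h1Seminorm T.carrier v ≤ C * T.diam⁻¹ * l2Norm T.carrier v := by
  obtain ⟨N, hN⟩ := exists_card_bound hC₂
  choose G hG hGb using fun n : ℕ => exists_norm_fderiv_le hC₁ hC₂ n
  have hsum : 0 ≤ ∑ n ∈ Finset.range (N + 1), G n := Finset.sum_nonneg fun n _ => hG n
  set b : ℝ := √(volume.real (Metric.ball (0 : Plane) 1))
  have hb0 : 0 ≤ b := Real.sqrt_nonneg _
  -- Since `T.n ≤ N`, the sum dominates every `G T.n` that occurs; the `1` makes the constant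
  -- positive.
  refine ⟨b * ∑ n ∈ Finset.range (N + 1), G n + 1, by positivity, fun 𝒯 h𝒯 T hT v hv => ?_⟩
  have hmin := h𝒯.le_minDist T hT
  have hd := T.diam_pos
  have hM0 : 0 ≤ l2Norm T.carrier v := Real.sqrt_nonneg _
  refine ⟨fun x hx => (contDiffAt_of_mem_shapeSpace hC₂ hmin hv hx).differentiableAt (by simp),
    integrableOn_sq hC₂ hmin hv, integrableOn_gradient_sq hC₂ hmin hv, ?_⟩
  have hGn := hG T.n
  refine (h1Seminorm_le (by positivity) hC₂ hmin hv
    (hGb T.n T rfl (h𝒯.diam_le T hT) hmin v hv)).trans ?_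
  have hle : G T.n ≤ ∑ n ∈ Finset.range (N + 1), G n :=
    Finset.single_le_sum (fun n _ => hG n)
      (Finset.mem_range.2 (Nat.lt_succ_of_le (hN T hmin)))
  calc b * T.diam * (G T.n * (T.diam ^ 2)⁻¹ * l2Norm T.carrier v)
      = b * G T.n * T.diam⁻¹ * l2Norm T.carrier v := by field_simp
    _ ≤ _ := by
      gcongr
      exact (mul_le_mul_of_nonneg_left hle hb0).trans (le_add_of_nonneg_right zero_le_one)
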